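/- **Theorem.** A signal is a sequence $x=(x[n])_{n\in\mathbb Z}$ of real numbers; if it has finite support $\{n : x[n]\neq 0\}$, its Fourier transform is $\hat x(\omega)=\sum_{n\in\mathbb Z}x[n]e^{-i\omega n}$ $(\omega\in\mathbb R)$. Let $N\ge 1$, and identify the signals vanishing outside $\{0,\dots,N-1\}$ with vectors in $\mathbb R^N$. Let $X_N\subset\mathbb R^N$ be the set of the non-negative signals with support $\{0,\dots,N-1\}$. Let $U_N$ be the set of all $x\in X_N$ that can be recovered from their Fourier intensity $|\hat x|$ uniquely up to reflection (and time shift) under the non-negativity constraint; that is, every non-negative signal $y$ with finite support and $|\hat y(\omega)|=|\hat x(\omega)|$ for all $\omega\in\mathbb R$ is of the form $y=(x[n-n_0])_{n}$ or $y=(x[n_0-n])_{n}$ for some $n_0\in\mathbb Z$. Let $A_N=X_N\setminus U_N$ be the set of signals that cannot be recovered uniquely. Then: 1. for every $N\ge 1$, the set $U_N$ is unbounded and contains a Borel measurable convex cone of infinite ($N$-dimensional) Lebesgue measure; 2. for every $N\ge 3$, the set $A_N$ is unbounded and contains a Borel measurable convex cone of infinite ($N$-dimensional) Lebesgue measure.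 Here a convex cone is a set closed under addition and under multiplication by positive real numbers. -/

import Mathlib

noncomputable section

namespace PhaseRetrieval

/-- The discrete-time Fourier transform `∑ₙ x[n] e^{-iωn}` of a signal; it is only used for
finitely supported signals, where the sum is finite. -/
def dtft (x : ℤ → ℝ) (ω : ℝ) : ℂ :=
  ∑' n : ℤ, (x n : ℂ) * Complex.exp (-Complex.I * (ω : ℂ) * (n : ℂ))

/-- The time shifted signal `(x[n - n₀])ₙ`. -/
def shift (n₀ : ℤ) (x : ℤ → ℝ) : ℤ → ℝ := fun n => x (n - n₀)

/-- The reflected signal `(x[-n])ₙ`. -/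
def reflect (x : ℤ → ℝ) : ℤ → ℝ := fun n => x (-n)

/-- `y` is a solution of the phase retrieval problem to recover `x` under the non-negativity
constraint: it is non-negative, has finite support, and has the Fourier intensity of `x`. -/
def IsNonnegSolution (x y : ℤ → ℝ) : Prop :=
  (Function.support y).Finite ∧ (∀ n, 0 ≤ y n) ∧ ∀ ω : ℝ, ‖dtft y ω‖ = ‖dtft x ω‖

/-- `y` arises from `x` by time shift and reflection. If both `x` and `y` have
support `{0, …, N-1}`, this says that `y = x` or `y[n] = x[N-1-n]` for all `n`. -/
def IsTrivialAmbiguity (x y : ℤ → ℝ) : Prop :=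
  ∃ n₀ : ℤ, y = shift n₀ x ∨ y = shift n₀ (reflect x)

/-- The identification of vectors in `ℝᴺ` with signals vanishing outside `{0, …, N-1}`. -/
def toSignal {N : ℕ} (v : Fin N → ℝ) : ℤ → ℝ := fun n =>
  if h : 0 ≤ n ∧ n < (N : ℤ) then v ⟨n.toNat, by omega⟩ else 0

/-- The non-negative signals whose support is `{0, …, N-1}`, as a subset of `ℝᴺ`. -/
def nonnegSignals (N : ℕ) : Set (Fin N → ℝ) :=
  {v | Function.support (toSignal v) = Set.Ico (0 : ℤ) (N : ℤ) ∧ ∀ n, 0 ≤ toSignal v n}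

/-- Signals that are recovered uniquely (up to trivial ambiguities). -/
def uniqueSignals (N : ℕ) : Set (Fin N → ℝ) :=
  {v | v ∈ nonnegSignals N ∧
    ∀ y : ℤ → ℝ, IsNonnegSolution (toSignal v) y → IsTrivialAmbiguity (toSignal v) y}

/-- Signals that are not recovered uniquely: there is a non-trivial non-negative solution. -/
def ambiguousSignals (N : ℕ) : Set (Fin N → ℝ) :=
  {v | v ∈ nonnegSignals N ∧
    ∃ y : ℤ → ℝ, IsNonnegSolution (toSignal v) y ∧ ¬ IsTrivialAmbiguity (toSignal v) y}

/-- `S` contains a (measurable, convex) cone of infinite Lebesgue measure. -/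
def ContainsInfiniteCone {N : ℕ} (S : Set (Fin N → ℝ)) : Prop :=
  ∃ K : ConvexCone ℝ (Fin N → ℝ),
    (K : Set (Fin N → ℝ)) ⊆ S ∧ MeasurableSet (K : Set (Fin N → ℝ)) ∧
      MeasureTheory.volume (K : Set (Fin N → ℝ)) = ⊤

end PhaseRetrieval

end

namespace PhaseRetrieval

open MeasureTheory Filter Topology
open scoped Pointwise

/-! ### Cones over neighbourhoods -/

/-! Both sets are invariant under positive scaling, so it suffices that each has an interior point:
the cone over a small ball is open and convex, and an open cone has infinite measure.

Unique signals: the intensity determines the autocorrelation (`autocorr_eq_of_norm_dtft_eq`). Take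
`x` with entries near 5/2 and 5/4 at its two ends and tiny entries between. A competitor `y`,
shifted and reflected so that its first entry is the larger end, also has a small interior. The
autocorrelations of `x` and `y` differ by half the symmetrized correlation of `x + y` with `x - y`;
since the first entry of `x + y` dominates, this cannot vanish at a lag where `|x - y|` is maximal
unless `x = y` (`eq_of_autocorr_eq`). For N = 1 the single entry is read off from its square.

Ambiguous signals: with `z = e^{-iω}`, write the signal as `(z + r) h` with `r > 1` and `h`
positive. Replacing `z + r` by `1 + r z` keeps the modulus on the unit circle and the signs of the
coefficients, and the result is non-trivial when the end coefficients of `h` differ. Such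
factorizations survive perturbation: a simple real root moves continuously, and so does the quotient
(`exists_ambiguousSignals_mem_nhds`). Different end coefficients require `h` to have degree at least
1, hence N ≥ 3. -/

theorem containsInfiniteCone_of_mem_nhds {N : ℕ} (hN : 0 < N) {S : Set (Fin N → ℝ)}
    (hS : ∀ c : ℝ, 0 < c → ∀ v ∈ S, c • v ∈ S) {v₀ : Fin N → ℝ} (h : S ∈ 𝓝 v₀) :
    ContainsInfiniteCone S := by
  obtain ⟨ε, hε, hb⟩ := Metric.mem_nhds_iff.1 h
  set K := ConvexCone.hull ℝ (Metric.ball v₀ ε)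
  have hKmem : ∀ u, u ∈ (K : Set (Fin N → ℝ)) ↔
      ∃ c : ℝ, 0 < c ∧ u ∈ c • Metric.ball v₀ ε :=
    fun u => ConvexCone.mem_hull_of_convex (convex_ball v₀ ε)
  have hopen : IsOpen (K : Set (Fin N → ℝ)) := by
    have : (K : Set (Fin N → ℝ)) =
        ⋃ c : {c : ℝ // 0 < c}, c.1 • Metric.ball v₀ ε := by
      ext u
      simp [hKmem]
    rw [this]
    exact isOpen_iUnion fun c => Metric.isOpen_ball.smul₀ c.2.ne'
  refine ⟨K, ?_, hopen.measurableSet, ?_⟩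
  · intro u hu
    obtain ⟨c, hc, w, hw, rfl⟩ := (hKmem u).1 hu
    exact hS c hc w (hb hw)
  · have hne : (K : Set (Fin N → ℝ)).Nonempty :=
      ⟨(1 : ℝ) • v₀, (hKmem _).2 ⟨1, one_pos, Set.smul_mem_smul_set (Metric.mem_ball_self hε)⟩⟩
    have hpos : volume (K : Set (Fin N → ℝ)) ≠ 0 := (hopen.measure_pos volume hne).ne'
    -- Doubling preserves the cone but multiplies its volume by `2 ^ N > 1`, so a positive volume
    -- must be infinite.
    have h2 : (2 : ℝ) • (K : Set (Fin N → ℝ)) = K := by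
      ext u
      constructor
      · rintro ⟨w, hw, rfl⟩
        exact K.smul_mem two_pos hw
      · intro hu
        refine ⟨(2⁻¹ : ℝ) • u, K.smul_mem (by norm_num) hu, ?_⟩
        simp
    have hvol := Measure.addHaar_smul (volume : Measure (Fin N → ℝ)) 2 (K : Set (Fin N → ℝ))
    rw [h2] at hvol
    by_contra htop
    have h3 := congrArg ENNReal.toReal hvol
    rw [ENNReal.toReal_mul, ENNReal.toReal_ofReal (abs_nonneg _)] at h3
    have h4 : 0 < (volume (K : Set (Fin N → ℝ))).toReal := ENNReal.toReal_pos hpos htop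
    have h5 : (1 : ℝ) < |2 ^ Module.finrank ℝ (Fin N → ℝ)| := by
      rw [abs_of_pos (by positivity)]
      exact one_lt_pow₀ one_lt_two (by simpa using hN.ne')
    nlinarith

theorem ContainsInfiniteCone.not_isBounded {N : ℕ} {S : Set (Fin N → ℝ)}
    (h : ContainsInfiniteCone S) : ¬ Bornology.IsBounded S := by
  obtain ⟨K, hKS, -, hK⟩ := h
  intro hb
  exact (hb.subset hKS).measure_lt_top.ne hK

/-! ### Scaling -/

theorem toSignal_smul {N : ℕ} (c : ℝ) (v : Fin N → ℝ) :
    toSignal (c • v) = fun n => c * toSignal v n := by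
  funext n
  unfold toSignal
  split_ifs <;> simp

theorem dtft_const_mul (c : ℝ) (x : ℤ → ℝ) (ω : ℝ) :
    dtft (fun n => c * x n) ω = c * dtft x ω := by
  unfold dtft
  rw [← tsum_mul_left]
  congr 1
  funext n
  push_cast
  ring

theorem smul_mem_nonnegSignals {N : ℕ} {c : ℝ} (hc : 0 < c) {v : Fin N → ℝ}
    (hv : v ∈ nonnegSignals N) : c • v ∈ nonnegSignals N := by
  refine ⟨?_, ?_⟩
  · rw [← hv.1, toSignal_smul]
    ext n
    simp [hc.ne']
  · intro n
    rw [toSignal_smul]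
    exact mul_nonneg hc.le (hv.2 n)

theorem smul_mem_uniqueSignals {N : ℕ} {c : ℝ} (hc : 0 < c) {v : Fin N → ℝ}
    (hv : v ∈ uniqueSignals N) : c • v ∈ uniqueSignals N := by
  refine ⟨smul_mem_nonnegSignals hc hv.1, fun y hy => ?_⟩
  obtain ⟨hfin, hnn, hint⟩ := hy
  have hsol : IsNonnegSolution (toSignal v) (fun n => c⁻¹ * y n) := by
    refine ⟨hfin.subset fun n hn => ?_, fun n => mul_nonneg (by positivity) (hnn n), fun ω => ?_⟩
    · exact right_ne_zero_of_mul hn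
    · rw [dtft_const_mul, norm_mul, hint, toSignal_smul, dtft_const_mul, norm_mul, ← mul_assoc,
        ← norm_mul, ← Complex.ofReal_mul, inv_mul_cancel₀ hc.ne']
      simp
  obtain ⟨n₀, h | h⟩ := hv.2 _ hsol
  · refine ⟨n₀, Or.inl ?_⟩
    funext n
    have := congrFun h n
    simp only [shift, toSignal_smul] at this ⊢
    rw [← this, mul_inv_cancel_left₀ hc.ne']
  · refine ⟨n₀, Or.inr ?_⟩
    funext n
    have := congrFun h n
    simp only [shift, reflect, toSignal_smul] at this ⊢
    rw [← this, mul_inv_cancel_left₀ hc.ne']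

theorem smul_mem_ambiguousSignals {N : ℕ} {c : ℝ} (hc : 0 < c) {v : Fin N → ℝ}
    (hv : v ∈ ambiguousSignals N) : c • v ∈ ambiguousSignals N := by
  have hdiff : ambiguousSignals N = nonnegSignals N \ uniqueSignals N := by
    ext u
    simp only [ambiguousSignals, uniqueSignals, Set.mem_ofPred_eq, Set.mem_sdiff]
    grind
  rw [hdiff] at hv ⊢
  refine ⟨smul_mem_nonnegSignals hc hv.1, fun h => hv.2 ?_⟩
  have := smul_mem_uniqueSignals (inv_pos.2 hc) h
  rwa [inv_smul_smul₀ hc.ne'] at this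

theorem eq_zero_of_notMem {x : ℤ → ℝ} {F : Finset ℤ} (hF : Function.support x ⊆ F) {n : ℤ}
    (hn : n ∉ F) : x n = 0 :=
  Function.notMem_support.1 fun h => hn (hF h)

/-! ### Fourier intensity and autocorrelation -/

/-- The autocorrelation `∑ₘ x[m] x[m+k]` of a signal. -/
noncomputable def autocorr (x : ℤ → ℝ) (k : ℤ) : ℝ := ∑' m : ℤ, x m * x (m + k)

theorem autocorr_eq_sum {x : ℤ → ℝ} {F : Finset ℤ} (hF : Function.support x ⊆ F) (k : ℤ) :
    autocorr x k = ∑ m ∈ F, x m * x (m + k) := by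
  refine tsum_eq_sum fun m hm => ?_
  rw [eq_zero_of_notMem hF hm, zero_mul]

theorem dtft_eq_sum {x : ℤ → ℝ} {F : Finset ℤ} (hF : Function.support x ⊆ F) (ω : ℝ) :
    dtft x ω = ∑ n ∈ F, (x n : ℂ) * Complex.exp (-Complex.I * ω * n) := by
  refine tsum_eq_sum fun m hm => ?_
  rw [eq_zero_of_notMem hF hm, Complex.ofReal_zero, zero_mul]

theorem integral_exp_I_mul_int (j : ℤ) :
    ∫ ω in (0 : ℝ)..2 * Real.pi, Complex.exp (Complex.I * j * ω) =
      if j = 0 then 2 * (Real.pi : ℂ) else 0 := by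
  split_ifs with hj
  · simp [hj]
  · have hc : Complex.I * (j : ℂ) ≠ 0 := mul_ne_zero Complex.I_ne_zero (by exact_mod_cast hj)
    rw [integral_exp_mul_complex hc]
    have : Complex.exp (Complex.I * j * ((2 * Real.pi : ℝ) : ℂ)) = 1 := by
      rw [← Complex.exp_int_mul_two_pi_mul_I j]
      congr 1
      push_cast
      ring
    rw [this]
    simp

/-- The squared intensity is a trigonometric polynomial whose Fourier coefficients are the
autocorrelation; orthogonality of exponentials keeps only the terms `m = n + k` of the double sum.
-/
theorem integral_norm_dtft_sq {x : ℤ → ℝ} (hx : (Function.support x).Finite) (k : ℤ) :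
    ∫ ω in (0 : ℝ)..2 * Real.pi, ((‖dtft x ω‖ : ℂ)) ^ 2 * Complex.exp (-Complex.I * k * ω) =
      2 * Real.pi * (autocorr x k : ℂ) := by
  set F := hx.toFinset with hFdef
  have hF : Function.support x ⊆ F := by simp [hFdef]
  have hexp : ∀ ω : ℝ, ((‖dtft x ω‖ : ℂ)) ^ 2 * Complex.exp (-Complex.I * k * ω) =
      ∑ n ∈ F, ∑ m ∈ F, (x n * x m : ℂ) * Complex.exp (Complex.I * (m - n - k : ℤ) * ω) := by
    intro ω
    rw [← Complex.mul_conj', dtft_eq_sum hF, map_sum, Finset.sum_mul_sum, Finset.sum_mul]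
    refine Finset.sum_congr rfl fun n _ => ?_
    rw [Finset.sum_mul]
    refine Finset.sum_congr rfl fun m _ => ?_
    rw [map_mul, Complex.conj_ofReal, ← Complex.exp_conj]
    have : Complex.exp (Complex.I * (m - n - k : ℤ) * ω) =
        Complex.exp (-Complex.I * ω * n) *
          Complex.exp ((starRingEnd ℂ) (-Complex.I * ω * m)) *
          Complex.exp (-Complex.I * k * ω) := by
      rw [← Complex.exp_add, ← Complex.exp_add]
      congr 1
      simp only [map_mul, map_neg, Complex.conj_I, Complex.conj_ofReal, map_intCast]
      push_cast
      ring
    rw [this]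
    ring
  simp_rw [hexp]
  have hcont : ∀ (a : ℂ) (j : ℤ), Continuous fun ω : ℝ =>
      a * Complex.exp (Complex.I * j * ω) := by
    intro a j
    fun_prop
  rw [intervalIntegral.integral_finsetSum fun n _ =>
    (continuous_finsetSum _ fun m _ => hcont _ _).intervalIntegrable _ _]
  rw [autocorr_eq_sum hF, Complex.ofReal_sum, Finset.mul_sum]
  refine Finset.sum_congr rfl fun n _ => ?_
  rw [intervalIntegral.integral_finsetSum fun m _ => (hcont _ _).intervalIntegrable _ _]
  simp_rw [intervalIntegral.integral_const_mul, integral_exp_I_mul_int]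
  have hiff : ∀ m : ℤ, (m - n - k = 0) ↔ (m = n + k) := fun m => by omega
  simp_rw [hiff, mul_ite, mul_zero, Finset.sum_ite_eq' F (n + k)]
  split_ifs with hmem
  · push_cast
    ring
  · rw [eq_zero_of_notMem hF hmem]
    simp

theorem autocorr_eq_of_norm_dtft_eq {x y : ℤ → ℝ} (hx : (Function.support x).Finite)
    (hy : (Function.support y).Finite) (h : ∀ ω : ℝ, ‖dtft y ω‖ = ‖dtft x ω‖) (k : ℤ) :
    autocorr y k = autocorr x k := by
  have h1 := integral_norm_dtft_sq hx k
  simp_rw [← h] at h1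
  rw [integral_norm_dtft_sq hy k] at h1
  have hpi : (2 * Real.pi : ℂ) ≠ 0 := by simp [Real.pi_ne_zero]
  exact_mod_cast mul_left_cancel₀ hpi h1

theorem autocorr_shift (n₀ : ℤ) (x : ℤ → ℝ) (k : ℤ) :
    autocorr (shift n₀ x) k = autocorr x k := by
  unfold autocorr shift
  rw [← (Equiv.subRight n₀).tsum_eq fun m => x m * x (m + k)]
  refine tsum_congr fun m => ?_
  simp only [Equiv.subRight_apply]
  rw [show m + k - n₀ = m - n₀ + k by ring]

theorem autocorr_reflect (x : ℤ → ℝ) (k : ℤ) :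
    autocorr (reflect x) k = autocorr x k := by
  unfold autocorr reflect
  rw [← (Equiv.subLeft (-k)).tsum_eq fun m => x m * x (m + k)]
  refine tsum_congr fun m => ?_
  simp only [Equiv.subLeft_apply]
  rw [mul_comm]
  congr 2 <;> ring

/-! ### Uniqueness -/

/-- Polarization: `2 (x x' - y y') = (x + y)(x' - y') + (x - y)(x' + y')`, with primes for the
translates by `k`. The substitution `m ↦ m + k` brings the second sum to the form with factor `x +
y`. -/
theorem autocorr_sub {x y : ℤ → ℝ} {F : Finset ℤ} (hx : Function.support x ⊆ F)
    (hy : Function.support y ⊆ F) (k : ℤ) :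
    2 * (autocorr x k - autocorr y k) =
      ∑ m ∈ F, (x m + y m) * ((x (m + k) - y (m + k)) + (x (m - k) - y (m - k))) := by
  have hswap : ∑ m ∈ F, (x m - y m) * (x (m + k) + y (m + k)) =
      ∑ m ∈ F, (x m + y m) * (x (m - k) - y (m - k)) := by
    have hz : ∀ m, m ∉ F → x m = 0 ∧ y m = 0 := fun m hm =>
      ⟨eq_zero_of_notMem hx hm, eq_zero_of_notMem hy hm⟩
    have h1 : ∑' m : ℤ, (x m - y m) * (x (m + k) + y (m + k)) =
        ∑ m ∈ F, (x m - y m) * (x (m + k) + y (m + k)) :=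
      tsum_eq_sum fun m hm => by rw [(hz m hm).1, (hz m hm).2]; ring
    have h2 : ∑' m : ℤ, (x m + y m) * (x (m - k) - y (m - k)) =
        ∑ m ∈ F, (x m + y m) * (x (m - k) - y (m - k)) :=
      tsum_eq_sum fun m hm => by rw [(hz m hm).1, (hz m hm).2]; ring
    rw [← h1, ← h2, ← (Equiv.addRight k).tsum_eq fun m => (x m + y m) * (x (m - k) - y (m - k))]
    refine tsum_congr fun m => ?_
    simp only [Equiv.coe_addRight, add_sub_cancel_right]
    ring
  simp_rw [mul_add, Finset.sum_add_distrib, ← hswap]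
  rw [autocorr_eq_sum hx, autocorr_eq_sum hy, ← Finset.sum_sub_distrib, Finset.mul_sum,
    ← Finset.sum_add_distrib]
  exact Finset.sum_congr rfl fun m _ => by ring

theorem sum_Icc_zero_eq {L : ℤ} (hL : 0 < L) (f : ℤ → ℝ) :
    ∑ m ∈ Finset.Icc 0 L, f m = f 0 + f L + ∑ m ∈ Finset.Ioo 0 L, f m := by
  rw [← Finset.Ioc_insert_left hL.le, Finset.sum_insert (by simp), ← Finset.Ioo_insert_right hL,
    Finset.sum_insert (by simp)]
  ring

/-- Signals are determined by their autocorrelation if the first entry of their sum dominates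
the remaining ones. -/
theorem eq_of_autocorr_eq {x y : ℤ → ℝ} {L : ℤ} (hL : 0 < L)
    (hx : Function.support x ⊆ Finset.Icc 0 L) (hy : Function.support y ⊆ Finset.Icc 0 L)
    (hx0 : ∀ n, 0 ≤ x n) (hy0 : ∀ n, 0 ≤ y n) (h : ∀ k, autocorr y k = autocorr x k)
    (hdom : x L + y L + 2 * ∑ m ∈ Finset.Ioo 0 L, (x m + y m) < x 0 + y 0) : y = x := by
  have hz : ∀ m, m ∉ Finset.Icc 0 L → x m = 0 ∧ y m = 0 := fun m hm =>
    ⟨eq_zero_of_notMem hx hm, eq_zero_of_notMem hy hm⟩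
  obtain ⟨k, hk, hmax⟩ := Finset.exists_max_image (Finset.Icc 0 L) (fun m => |x m - y m|)
    ⟨0, by simp [hL.le]⟩
  set M := |x k - y k| with hM
  have hle : ∀ m, |x m - y m| ≤ M := by
    intro m
    by_cases hm : m ∈ Finset.Icc 0 L
    · exact hmax m hm
    · rw [(hz m hm).1, (hz m hm).2]
      simp [hM]
  suffices hM0 : M ≤ 0 by
    funext m
    have := abs_nonpos_iff.1 ((hle m).trans hM0)
    linarith
  by_contra! hMpos
  have hsum := autocorr_sub hx hy k
  rw [h k, sub_self, mul_zero, sum_Icc_zero_eq hL] at hsum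
  have hmid : |∑ m ∈ Finset.Ioo 0 L,
      (x m + y m) * ((x (m + k) - y (m + k)) + (x (m - k) - y (m - k)))| ≤
      2 * M * ∑ m ∈ Finset.Ioo 0 L, (x m + y m) := by
    rw [Finset.mul_sum]
    refine (Finset.abs_sum_le_sum_abs _ _).trans (Finset.sum_le_sum fun m _ => ?_)
    rw [abs_mul, abs_of_nonneg (add_nonneg (hx0 m) (hy0 m)), mul_comm]
    refine mul_le_mul_of_nonneg_right ?_ (add_nonneg (hx0 m) (hy0 m))
    exact (abs_add_le _ _).trans (by linarith [hle (m + k), hle (m - k)])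
  set T := ∑ m ∈ Finset.Ioo 0 L, (x m + y m)
  set R := ∑ m ∈ Finset.Ioo 0 L,
      (x m + y m) * ((x (m + k) - y (m + k)) + (x (m - k) - y (m - k)))
  have hs0 : 0 ≤ x 0 + y 0 := add_nonneg (hx0 0) (hy0 0)
  have hsL : 0 ≤ x L + y L := add_nonneg (hx0 L) (hy0 L)
  have hT : 0 ≤ T := Finset.sum_nonneg fun m _ => add_nonneg (hx0 m) (hy0 m)
  rw [Finset.mem_Icc] at hk
  -- For `k = 0` the two translates coincide, whence `c = 2`. For `k > 0` the positions `-k` and `L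
  -- + k` lie outside the support, whence `c = 1`.
  obtain ⟨c, hc, hfirst, hlast⟩ : ∃ c : ℝ, 1 ≤ c ∧
      |(x (0 + k) - y (0 + k)) + (x (0 - k) - y (0 - k))| = c * M ∧
      |(x (L + k) - y (L + k)) + (x (L - k) - y (L - k))| ≤ c * M := by
    rcases hk.1.eq_or_lt with rfl | hk0
    · refine ⟨2, by norm_num, ?_, ?_⟩
      · simp only [add_zero, sub_zero, hM]
        rw [← two_mul, abs_mul, abs_two]
      · refine (abs_add_le _ _).trans ?_
        linarith [hle (L + 0), hle (L - 0)]
    · refine ⟨1, le_rfl, ?_, ?_⟩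
      · have := hz (0 - k) (by simp; omega)
        rw [this.1, this.2]
        simp [hM]
      · have := hz (L + k) (by simp; omega)
        rw [this.1, this.2]
        simpa using hle (L - k)
  have h1 : (x 0 + y 0) * (c * M) ≤ (x L + y L) * (c * M) + 2 * M * T := by
    have habs : (x 0 + y 0) * (c * M) =
        |(x 0 + y 0) * ((x (0 + k) - y (0 + k)) + (x (0 - k) - y (0 - k)))| := by
      rw [abs_mul, abs_of_nonneg hs0, hfirst]
    rw [habs, show (x 0 + y 0) * ((x (0 + k) - y (0 + k)) + (x (0 - k) - y (0 - k))) =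
      -((x L + y L) * ((x (L + k) - y (L + k)) + (x (L - k) - y (L - k))) + R) by linarith, abs_neg]
    refine (abs_add_le _ _).trans (add_le_add ?_ hmid)
    rw [abs_mul, abs_of_nonneg hsL]
    exact mul_le_mul_of_nonneg_left hlast hsL
  have h2 : 2 * M * T ≤ c * M * (2 * T) := by
    nlinarith [mul_nonneg hMpos.le hT]
  have h3 : (0 : ℝ) < c * M := by positivity
  nlinarith

theorem autocorr_top {x : ℤ → ℝ} {L : ℤ} (hL : 0 ≤ L)
    (hx : Function.support x ⊆ Finset.Icc 0 L) : autocorr x L = x 0 * x L := by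
  rw [autocorr_eq_sum hx, Finset.sum_eq_single 0]
  · simp
  · intro m hm h0
    rw [Finset.mem_Icc] at hm
    rw [eq_zero_of_notMem hx (n := m + L) (by rw [Finset.mem_Icc]; omega), mul_zero]
  · simp [hL]

theorem autocorr_of_lt {x : ℤ → ℝ} {L k : ℤ} (hk : L < k)
    (hx : Function.support x ⊆ Finset.Icc 0 L) : autocorr x k = 0 := by
  rw [autocorr_eq_sum hx]
  refine Finset.sum_eq_zero fun m hm => ?_
  rw [Finset.mem_Icc] at hm
  rw [eq_zero_of_notMem hx (n := m + k) (by rw [Finset.mem_Icc]; omega), mul_zero]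

/-- A finitely supported signal whose autocorrelation has exact degree `L` can be shifted to have
support of exact extent `{0, …, L}`. -/
theorem exists_shift_support {x y : ℤ → ℝ} {L : ℤ} (hL : 0 ≤ L)
    (hx : Function.support x ⊆ Finset.Icc 0 L) (hx0 : x 0 ≠ 0) (hxL : x L ≠ 0)
    (hy : (Function.support y).Finite) (h : ∀ k, autocorr y k = autocorr x k) :
    ∃ n₀ : ℤ, Function.support (shift n₀ y) ⊆ Finset.Icc 0 L := by
  set F := hy.toFinset with hFdef
  have hF : ∀ n, n ∈ F ↔ y n ≠ 0 := by simp [hFdef]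
  have hne : F.Nonempty := by
    by_contra hne
    rw [Finset.not_nonempty_iff_eq_empty] at hne
    have h1 := h L
    rw [autocorr_top hL hx, autocorr_eq_sum (F := F) (fun n hn => (hF n).2 hn), hne] at h1
    exact mul_ne_zero hx0 hxL (by simpa using h1.symm)
  set a := F.min' hne
  set b := F.max' hne
  have hsupp : Function.support (shift (-a) y) ⊆ Finset.Icc 0 (b - a) := by
    intro n hn
    have hn' : n + a ∈ F := (hF _).2 (by simpa [shift] using hn)
    have h1 := F.min'_le _ hn'
    have h2 := F.le_max' _ hn'
    simp only [Finset.coe_Icc, Set.mem_Icc]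
    omega
  have hab : 0 ≤ b - a := sub_nonneg.2 (F.min'_le _ (F.max'_mem hne))
  have htop := autocorr_top hab hsupp
  rw [autocorr_shift, h] at htop
  have hpos : shift (-a) y 0 * shift (-a) y (b - a) ≠ 0 := by
    simp only [shift]
    refine mul_ne_zero ?_ ?_
    · simpa using (hF _).1 (F.min'_mem hne)
    · simpa using (hF _).1 (F.max'_mem hne)
  refine ⟨-a, hsupp.trans ?_⟩
  have : b - a ≤ L := by
    by_contra! hlt
    rw [autocorr_of_lt hlt hx] at htop
    exact hpos htop.symm
  exact_mod_cast Finset.Icc_subset_Icc_right this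

theorem reflect_support_subset {y : ℤ → ℝ} {L : ℤ}
    (hy : Function.support y ⊆ Finset.Icc 0 L) :
    Function.support (shift L (reflect y)) ⊆ Finset.Icc 0 L := by
  intro n hn
  have : -(n - L) ∈ Finset.Icc 0 L := hy hn
  simp only [Finset.coe_Icc, Set.mem_Icc, Finset.mem_Icc] at *
  omega

/-- A signal with two dominating end points of different size is determined by its
autocorrelation among the non-negative signals on `{0, …, L}`, up to reflection. -/
theorem eq_of_autocorr_eq_of_small {x y : ℤ → ℝ} {L : ℤ} (hL : 0 < L) {δ : ℝ}
    (hδ : δ * (20 * (L + 1 : ℝ) ^ 2) ≤ 1) (hδ0 : 0 < δ)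
    (hx : Function.support x ⊆ Finset.Icc 0 L) (hy : Function.support y ⊆ Finset.Icc 0 L)
    (hx0 : ∀ n, 0 ≤ x n) (hy0 : ∀ n, 0 ≤ y n) (h : ∀ k, autocorr y k = autocorr x k)
    (h0 : x 0 ∈ Set.Ioo (2 : ℝ) 3) (hxL : x L ∈ Set.Ioo (1 : ℝ) (3 / 2))
    (hmid : ∀ m ∈ Finset.Ioo 0 L, x m ≤ δ) (hyy : y L ≤ y 0) : y = x := by
  have hLr : (1 : ℝ) ≤ L := by exact_mod_cast hL
  have hδ1 : δ ≤ 1 := by nlinarith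
  refine eq_of_autocorr_eq hL hx hy hx0 hy0 h ?_
  have hx3 : ∀ m, x m ≤ 3 := by
    intro m
    by_cases hm : m ∈ Finset.Icc 0 L
    · rw [Finset.mem_Icc] at hm
      rcases hm.1.eq_or_lt with rfl | h1
      · exact h0.2.le
      rcases hm.2.eq_or_lt with rfl | h2
      · linarith [hxL.2]
      linarith [hmid m (Finset.mem_Ioo.2 ⟨h1, h2⟩)]
    · rw [eq_zero_of_notMem hx hm]
      norm_num
  -- The end products agree, so `y 0 * y L = x 0 * x L > 2`, and `y 0` is the larger factor.
  have hy1 : 1 ≤ y 0 := by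
    have h1 := h L
    rw [autocorr_top hL.le hx, autocorr_top hL.le hy] at h1
    nlinarith [h0.1, hxL.1, hy0 0, hy0 L]
  have hymid : ∀ k ∈ Finset.Ioo 0 L, y k ≤ 3 * (L + 1) * δ := by
    intro k hk
    have hk' := Finset.mem_Ioo.1 hk
    have h1 : y 0 * y k ≤ autocorr y k := by
      rw [autocorr_eq_sum hy]
      have := Finset.single_le_sum (f := fun m => y m * y (m + k))
        (fun m _ => mul_nonneg (hy0 m) (hy0 (m + k))) (Finset.mem_Icc.2 ⟨le_rfl, hL.le⟩)
      simpa using this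
    have h2 : autocorr x k ≤ 3 * (L + 1) * δ := by
      rw [autocorr_eq_sum hx]
      -- As `0 < k < L`, each product either has an interior factor, at most `δ`, or vanishes (`m =
      -- L`).
      have hterm : ∀ m ∈ Finset.Icc 0 L, x m * x (m + k) ≤ 3 * δ := by
        intro m hm
        rw [Finset.mem_Icc] at hm
        rcases hm.1.eq_or_lt with rfl | h1
        · rw [zero_add]
          exact mul_le_mul (hx3 0) (hmid k hk) (hx0 k) (by norm_num)
        rcases hm.2.eq_or_lt with rfl | h2
        · rw [eq_zero_of_notMem hx (n := m + k) (by rw [Finset.mem_Icc]; omega), mul_zero]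
          positivity
        · rw [mul_comm]
          exact mul_le_mul (hx3 _) (hmid m (Finset.mem_Ioo.2 ⟨h1, h2⟩)) (hx0 m) (by norm_num)
      refine (Finset.sum_le_card_nsmul _ _ _ hterm).trans_eq ?_
      have hcard : (((Finset.Icc 0 L).card : ℕ) : ℝ) = L + 1 := by
        have : (((Finset.Icc 0 L).card : ℕ) : ℤ) = L + 1 := by
          rw [Int.card_Icc]
          omega
        exact_mod_cast this
      rw [nsmul_eq_mul, hcard]
      ring
    rw [h k] at h1
    nlinarith [hy0 k]
  have hT : ∑ m ∈ Finset.Ioo 0 L, (x m + y m) ≤ L * (δ + 3 * (L + 1) * δ) := by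
    refine (Finset.sum_le_card_nsmul _ _ _ fun m hm =>
      add_le_add (hmid m hm) (hymid m hm)).trans ?_
    rw [nsmul_eq_mul]
    refine mul_le_mul_of_nonneg_right ?_ (by positivity)
    have : (((Finset.Ioo 0 L).card : ℕ) : ℤ) ≤ L := by
      rw [Int.card_Ioo]
      omega
    exact_mod_cast this
  -- The left side is at most `4 (L + 1)² δ`, which explains the 20. Twice it is below the gap `x 0
  -- - x L > 1/2`, while `y L ≤ y 0` only helps.
  have hbound : L * (δ + 3 * (L + 1) * δ) ≤ (1 : ℝ) / 5 := by
    nlinarith [mul_pos hδ0 (by linarith : (0 : ℝ) < L)]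
  linarith [h0.1, hxL.2]

/-! ### An open box of uniquely recoverable vectors -/

theorem isTrivialAmbiguity_of_shift_eq {x y : ℤ → ℝ} {n₀ : ℤ} (h : shift n₀ y = x) :
    IsTrivialAmbiguity x y := by
  refine ⟨-n₀, Or.inl ?_⟩
  rw [← h]
  funext n
  simp [shift]

theorem isTrivialAmbiguity_of_reflect_eq {x y : ℤ → ℝ} {n₀ L : ℤ}
    (h : shift L (reflect (shift n₀ y)) = x) : IsTrivialAmbiguity x y := by
  refine ⟨L - n₀, Or.inr ?_⟩
  rw [← h]
  funext n
  simp only [shift, reflect]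
  congr 1
  ring

theorem toSignal_support_subset {N : ℕ} (v : Fin N → ℝ) :
    Function.support (toSignal v) ⊆ Finset.Icc 0 ((N : ℤ) - 1) := by
  intro n hn
  simp only [Function.mem_support, toSignal] at hn
  split_ifs at hn with h
  · simp only [Finset.coe_Icc, Set.mem_Icc]
    omega
  · exact absurd rfl hn

theorem toSignal_natCast {N : ℕ} (v : Fin N → ℝ) (i : Fin N) : toSignal v (i : ℕ) = v i := by
  simp [toSignal]

theorem mem_nonnegSignals_of_pos {N : ℕ} {v : Fin N → ℝ} (hv : ∀ i, 0 < v i) :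
    v ∈ nonnegSignals N := by
  constructor
  · ext n
    simp only [Function.mem_support, toSignal, Set.mem_Ico]
    split_ifs with h
    · simp [h, (hv _).ne']
    · simp [h]
  · intro n
    simp only [toSignal]
    split_ifs
    exacts [(hv _).le, le_rfl]

theorem mem_uniqueSignals_of_small {N : ℕ} (hN : 2 ≤ N) {δ : ℝ} (hδ0 : 0 < δ)
    (hδ : δ * (20 * (N : ℝ) ^ 2) ≤ 1) {v : Fin N → ℝ} (hv : ∀ i, 0 < v i)
    (h0 : v ⟨0, by omega⟩ ∈ Set.Ioo (2 : ℝ) 3)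
    (hlast : v ⟨N - 1, by omega⟩ ∈ Set.Ioo (1 : ℝ) (3 / 2))
    (hmid : ∀ i : Fin N, 0 < i.1 → i.1 < N - 1 → v i ≤ δ) : v ∈ uniqueSignals N := by
  have hvX := mem_nonnegSignals_of_pos hv
  refine ⟨hvX, fun y ⟨hyfin, hynn, hyint⟩ => ?_⟩
  obtain ⟨L, hL⟩ : ∃ L : ℤ, L = (N : ℤ) - 1 := ⟨_, rfl⟩
  have hLpos : 0 < L := by omega
  set x := toSignal v with hxdef
  have hx : Function.support x ⊆ Finset.Icc 0 L := hL ▸ toSignal_support_subset v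
  have hx0 : x 0 = v ⟨0, by omega⟩ := toSignal_natCast v ⟨0, by omega⟩
  have hxL : x L = v ⟨N - 1, by omega⟩ := by
    rw [← toSignal_natCast v ⟨N - 1, by omega⟩, hxdef]
    congr 1
    simp only
    omega
  have hxmid : ∀ m ∈ Finset.Ioo 0 L, x m ≤ δ := by
    intro m hm
    rw [Finset.mem_Ioo] at hm
    obtain ⟨k, rfl⟩ := Int.eq_ofNat_of_zero_le hm.1.le
    have hk := toSignal_natCast v ⟨k, by omega⟩
    rw [hxdef, hk]
    exact hmid _ (by simp only; omega) (by simp only; omega)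
  have hδ' : δ * (20 * (L + 1 : ℝ) ^ 2) ≤ 1 := by
    rw [hL]
    push_cast
    simpa using hδ
  have hauto := autocorr_eq_of_norm_dtft_eq
    (Set.Finite.subset (Finset.finite_toSet _) hx) hyfin hyint
  rw [← hx0] at h0
  rw [← hxL] at hlast
  obtain ⟨n₀, hn₀⟩ := exists_shift_support hLpos.le hx (by linarith [h0.1]) (by linarith [hlast.1])
    hyfin hauto
  -- Reflection is allowed, so the larger end of `y` can be placed at 0.
  rcases le_total (shift n₀ y L) (shift n₀ y 0) with hle | hle
  · refine isTrivialAmbiguity_of_shift_eq (n₀ := n₀) ?_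
    exact eq_of_autocorr_eq_of_small hLpos hδ' hδ0 hx hn₀ hvX.2 (fun n => hynn _)
      (fun k => by rw [autocorr_shift, hauto]) h0 hlast hxmid hle
  · refine isTrivialAmbiguity_of_reflect_eq (n₀ := n₀) (L := L) ?_
    refine eq_of_autocorr_eq_of_small hLpos hδ' hδ0 hx (reflect_support_subset hn₀) hvX.2
      (fun n => hynn _) (fun k => by rw [autocorr_shift, autocorr_reflect, autocorr_shift, hauto])
      h0 hlast hxmid ?_
    simpa [shift, reflect] using hle

theorem mem_uniqueSignals_one {v : Fin 1 → ℝ} (hv : ∀ i, 0 < v i) : v ∈ uniqueSignals 1 := by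
  have hvX := mem_nonnegSignals_of_pos hv
  refine ⟨hvX, fun y ⟨hyfin, hynn, hyint⟩ => ?_⟩
  have hx : Function.support (toSignal v) ⊆ (Finset.Icc 0 0 : Finset ℤ) := by
    simpa using toSignal_support_subset v
  have hx0 : toSignal v 0 = v 0 := toSignal_natCast v 0
  have hauto := autocorr_eq_of_norm_dtft_eq
    (Set.Finite.subset (Finset.finite_toSet _) hx) hyfin hyint
  have hne : toSignal v 0 ≠ 0 := hx0 ▸ (hv 0).ne'
  obtain ⟨n₀, hn₀⟩ := exists_shift_support le_rfl hx hne hne hyfin hauto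
  refine isTrivialAmbiguity_of_shift_eq (n₀ := n₀) ?_
  have h1 : autocorr (shift n₀ y) 0 = autocorr (toSignal v) 0 := by rw [autocorr_shift, hauto]
  rw [autocorr_top le_rfl hn₀, autocorr_top le_rfl hx] at h1
  funext n
  by_cases hn : n = 0
  · subst hn
    have h2 : 0 ≤ shift n₀ y 0 := hynn _
    exact (mul_self_inj h2 (hvX.2 0)).1 h1
  · have hmem : n ∉ Finset.Icc 0 0 := by simpa using hn
    rw [eq_zero_of_notMem hn₀ hmem, eq_zero_of_notMem hx hmem]

theorem exists_uniqueSignals_mem_nhds {N : ℕ} (hN : 0 < N) :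
    ∃ v₀ : Fin N → ℝ, uniqueSignals N ∈ 𝓝 v₀ := by
  have hpi : ∀ (I : Fin N → Set ℝ) (v₀ : Fin N → ℝ), (∀ i, I i ∈ 𝓝 (v₀ i)) →
      (∀ v : Fin N → ℝ, (∀ i, v i ∈ I i) → v ∈ uniqueSignals N) → uniqueSignals N ∈ 𝓝 v₀ := by
    intro I v₀ hI hsub
    filter_upwards [set_pi_mem_nhds Set.finite_univ fun i _ => hI i] with v hv
    exact hsub v fun i => hv i trivial
  rcases Nat.lt_or_ge 1 N with hN2 | hN1
  · set δ : ℝ := 1 / (20 * (N : ℝ) ^ 2)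
    have hNr : (0 : ℝ) < N := by exact_mod_cast hN
    have hδ0 : 0 < δ := by positivity
    have hδ : δ * (20 * (N : ℝ) ^ 2) ≤ 1 := by
      rw [one_div_mul_cancel (by positivity)]
    refine ⟨fun i => if i.1 = 0 then 5 / 2 else if i.1 = N - 1 then 5 / 4 else δ / 2,
      hpi (fun i => if i.1 = 0 then Set.Ioo 2 3 else if i.1 = N - 1 then Set.Ioo 1 (3 / 2)
        else Set.Ioo 0 δ) _ (fun i => ?_) fun v hv => ?_⟩
    · split_ifs
      · exact Ioo_mem_nhds (by norm_num) (by norm_num)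
      · exact Ioo_mem_nhds (by norm_num) (by norm_num)
      · exact Ioo_mem_nhds (by linarith) (by linarith)
    · refine mem_uniqueSignals_of_small hN2 hδ0 hδ (fun i => ?_) ?_ ?_ fun i h1 h2 => ?_
      · have := hv i
        split_ifs at this <;> linarith [this.1]
      · simpa using hv ⟨0, by omega⟩
      · have := hv ⟨N - 1, by omega⟩
        rwa [if_neg (by simp only; omega), if_pos rfl] at this
      · have := hv i
        rw [if_neg (by omega), if_neg (by omega)] at this
        exact this.2.le
  · obtain rfl : N = 1 := by omega
    exact ⟨fun _ => 1, hpi (fun _ => Set.Ioi 0) _ (fun _ => Ioi_mem_nhds one_pos)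
      fun v hv => mem_uniqueSignals_one hv⟩

/-! ### Ambiguity -/

/-- The coefficients of the formal power series quotient of `∑ₖ c[k] zᵏ` by `z + r`. -/
noncomputable def quotCoeff (r : ℝ) (c : ℕ → ℝ) : ℕ → ℝ
  | 0 => c 0 / r
  | k + 1 => (c (k + 1) - quotCoeff r c k) / r

theorem continuousAt_quotCoeff {X : Type*} [TopologicalSpace X] {r : X → ℝ} {c : X → ℕ → ℝ}
    {a : X} (hr : ContinuousAt r a) (hr0 : r a ≠ 0) (hc : ∀ k, ContinuousAt (fun t => c t k) a)
    (k : ℕ) : ContinuousAt (fun t => quotCoeff (r t) (c t) k) a := by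
  induction k with
  | zero => exact (hc 0).div hr hr0
  | succ k ih => exact ((hc (k + 1)).sub ih).div hr hr0

theorem continuousAt_quotCoeff_left {r : ℝ} (hr : r ≠ 0) (c : ℕ → ℝ) (k : ℕ) :
    ContinuousAt (fun t => quotCoeff t c k) r :=
  continuousAt_quotCoeff (r := id) (c := fun _ => c) continuousAt_id hr
    (fun _ => continuousAt_const) k

/-- Coefficients of the product of `z + r` and `∑ₖ h[k] zᵏ`. -/
def mulCoeff (r : ℝ) (h : ℕ → ℝ) : ℕ → ℝ
  | 0 => r * h 0
  | k + 1 => r * h (k + 1) + h k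

/-- As power series, `(z + s) h / (z + r) = h + (s - r) h / (z + r)`. -/
theorem quotCoeff_mulCoeff {r : ℝ} (hr : r ≠ 0) (s : ℝ) (h : ℕ → ℝ) (k : ℕ) :
    quotCoeff r (mulCoeff s h) k = h k + (s - r) * quotCoeff r h k := by
  induction k with
  | zero =>
    simp only [quotCoeff, mulCoeff]
    field_simp
    ring
  | succ k ih =>
    simp only [quotCoeff, mulCoeff, ih]
    field_simp
    ring

theorem mulCoeff_quotCoeff {r : ℝ} (hr : r ≠ 0) (c : ℕ → ℝ) (k : ℕ) :
    mulCoeff r (quotCoeff r c) k = c k := by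
  cases k with
  | zero =>
    simp only [quotCoeff, mulCoeff]
    field_simp
  | succ k =>
    simp only [quotCoeff, mulCoeff]
    field_simp
    ring

/-- For a polynomial of degree at most `L`, the coefficient of order `L` is its value at `-r` up to
a nonzero factor. Divisibility by `z + r` is thus one scalar equation. -/
theorem quotCoeff_eq_zero {r : ℝ} {c : ℕ → ℝ} {L : ℕ} (hL : quotCoeff r c L = 0)
    (hc : ∀ k, L < k → c k = 0) {k : ℕ} (hk : L ≤ k) : quotCoeff r c k = 0 := by
  induction k, hk using Nat.le_induction with
  | base => exact hL
  | succ k hk ih => simp [quotCoeff, ih, hc (k + 1) (by omega)]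

/-! ### Replacing the factor `z + r` by `1 + r z` -/

theorem dtft_shift_one (h : ℤ → ℝ) (ω : ℝ) :
    dtft (shift 1 h) ω = Complex.exp (-Complex.I * ω) * dtft h ω := by
  unfold dtft shift
  rw [← (Equiv.addRight (1 : ℤ)).tsum_eq, ← tsum_mul_left]
  refine tsum_congr fun n => ?_
  simp only [Equiv.coe_addRight, add_sub_cancel_right]
  rw [mul_left_comm, ← Complex.exp_add]
  congr 2
  push_cast
  ring

theorem dtft_add {x y : ℤ → ℝ} (hx : (Function.support x).Finite)
    (hy : (Function.support y).Finite) (ω : ℝ) :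
    dtft (fun n => x n + y n) ω = dtft x ω + dtft y ω := by
  set F := (hx.union hy).toFinset with hF
  have h1 : Function.support x ⊆ F := by simp [hF]
  have h2 : Function.support y ⊆ F := by simp [hF]
  have h3 : Function.support (fun n => x n + y n) ⊆ F := by
    intro n hn
    by_contra hnF
    refine hn ?_
    simp only
    rw [eq_zero_of_notMem h1 hnF, eq_zero_of_notMem h2 hnF, add_zero]
  rw [dtft_eq_sum h1, dtft_eq_sum h2, dtft_eq_sum h3, ← Finset.sum_add_distrib]
  refine Finset.sum_congr rfl fun n _ => ?_
  push_cast
  ring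

/-- On the unit circle `1 + r z` is the conjugate of `r + z` times `z`. -/
theorem norm_real_add_unit (r : ℝ) {z : ℂ} (hz : ‖z‖ = 1) :
    ‖(r : ℂ) + z‖ = ‖1 + (r : ℂ) * z‖ := by
  have hz' : (starRingEnd ℂ) z * z = 1 := by
    rw [mul_comm, Complex.mul_conj', hz]
    simp
  calc ‖(r : ℂ) + z‖ = ‖(starRingEnd ℂ) ((r : ℂ) + z)‖ * ‖z‖ := by
        rw [Complex.norm_conj, hz, mul_one]
    _ = ‖1 + (r : ℂ) * z‖ := by
        rw [← norm_mul, map_add, Complex.conj_ofReal, add_mul, hz', add_comm]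

theorem finite_support_shift {x : ℤ → ℝ} (hx : (Function.support x).Finite) (n₀ : ℤ) :
    (Function.support (shift n₀ x)).Finite :=
  hx.preimage (sub_left_injective (b := n₀)).injOn

theorem finite_support_const_mul {x : ℤ → ℝ} (hx : (Function.support x).Finite) (c : ℝ) :
    (Function.support fun n => c * x n).Finite :=
  hx.subset fun _ hn => right_ne_zero_of_mul hn

theorem norm_dtft_flip {h : ℤ → ℝ} (hh : (Function.support h).Finite) (r ω : ℝ) :
    ‖dtft (fun n => h n + r * shift 1 h n) ω‖ = ‖dtft (fun n => r * h n + shift 1 h n) ω‖ := by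
  have hs := finite_support_shift hh 1
  rw [dtft_add hh (finite_support_const_mul hs r), dtft_add (finite_support_const_mul hh r) hs,
    dtft_const_mul, dtft_const_mul, dtft_shift_one]
  have hz : ‖Complex.exp (-Complex.I * ω)‖ = 1 := by
    rw [Complex.norm_exp]
    simp
  calc _ = ‖(1 + (r : ℂ) * Complex.exp (-Complex.I * ω)) * dtft h ω‖ := by ring_nf
    _ = ‖((r : ℂ) + Complex.exp (-Complex.I * ω)) * dtft h ω‖ := by
        rw [norm_mul, norm_mul, norm_real_add_unit r hz]
    _ = _ := by ring_nf

theorem toSignal_continuous {N : ℕ} (n : ℤ) : Continuous fun v : Fin N → ℝ => toSignal v n := by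
  unfold toSignal
  split_ifs
  · exact continuous_apply _
  · exact continuous_const

/-- A signal whose polynomial is `(z + r) h` with `r > 1` and `h` a positive polynomial of degree
at least one with different end coefficients is ambiguous. -/
theorem mem_ambiguousSignals_of_quotCoeff {L : ℕ} (hL : 2 ≤ L) {v : Fin (L + 1) → ℝ} {r : ℝ}
    (hr : 1 < r) (hroot : quotCoeff r (fun k => toSignal v k) L = 0)
    (hpos : ∀ k < L, 0 < quotCoeff r (fun k => toSignal v k) k)
    (hne : quotCoeff r (fun k => toSignal v k) 0 ≠ quotCoeff r (fun k => toSignal v k) (L - 1)) :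
    v ∈ ambiguousSignals (L + 1) := by
  set q := quotCoeff r (fun k => toSignal v k) with hq
  have hr0 : 0 < r := by linarith
  have hvsupp := toSignal_support_subset v
  have hq0 : ∀ k, L ≤ k → q k = 0 := fun k hk => quotCoeff_eq_zero hroot (fun j hj =>
    eq_zero_of_notMem hvsupp (by rw [Finset.mem_Icc]; omega)) hk
  have hqnn : ∀ k, 0 ≤ q k := fun k => by
    rcases lt_or_ge k L with hk | hk
    exacts [(hpos k hk).le, (hq0 k hk).ge]
  set h : ℤ → ℝ := fun n => if 0 ≤ n then q n.toNat else 0 with hh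
  have hhnat : ∀ k : ℕ, h k = q k := fun k => by simp [hh]
  have hhneg : ∀ n : ℤ, n < 0 → h n = 0 := fun n hn => by simp [hh, hn]
  have hhnn : ∀ n, 0 ≤ h n := fun n => by
    simp only [hh]
    split_ifs
    exacts [hqnn _, le_rfl]
  have hhfin : (Function.support h).Finite := by
    refine (Set.finite_Ico (0 : ℤ) L).subset fun n hn => ?_
    by_contra hmem
    rcases lt_or_ge n 0 with hn0 | hn0
    · exact hn (hhneg n hn0)
    · lift n to ℕ using hn0
      refine hn ?_
      rw [hhnat, hq0]
      simp only [Set.mem_Ico, not_and, not_lt] at hmem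
      exact_mod_cast hmem (by positivity)
  have hx : toSignal v = fun n => r * h n + shift 1 h n := by
    funext n
    simp only [shift]
    rcases lt_or_ge n 0 with hn0 | hn0
    · rw [hhneg n hn0, hhneg _ (by omega),
        eq_zero_of_notMem hvsupp (by rw [Finset.mem_Icc]; omega)]
      simp
    · lift n to ℕ using hn0
      have := mulCoeff_quotCoeff hr0.ne' (fun k => toSignal v k) n
      rw [← this, ← hq]
      cases n with
      | zero => simp [mulCoeff, hhneg, ← hhnat]
      | succ k =>
        rw [mulCoeff, hhnat, show ((k + 1 : ℕ) : ℤ) - 1 = k by push_cast; ring, hhnat]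
  have hvpos : ∀ i, 0 < v i := by
    intro i
    rw [← toSignal_natCast v i, hx]
    simp only [shift]
    rcases Nat.lt_or_ge i.1 L with hi | hi
    · have := hpos _ hi
      rw [← hhnat] at this
      have h2 := hhnn ((i.1 : ℤ) - 1)
      positivity
    · have hi2 : i.1 - 1 < L := by omega
      have := hpos _ hi2
      rw [← hhnat, show ((i.1 - 1 : ℕ) : ℤ) = (i.1 : ℤ) - 1 by omega] at this
      have h2 := hhnn (i.1 : ℤ)
      positivity
  refine ⟨mem_nonnegSignals_of_pos hvpos, fun n => h n + r * shift 1 h n, ⟨?_, fun n => ?_, ?_⟩, ?_⟩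
  · refine (hhfin.union (finite_support_const_mul (finite_support_shift hhfin 1) r)).subset ?_
    exact Function.support_add _ _
  · exact add_nonneg (hhnn n) (mul_nonneg hr0.le (hhnn _))
  · intro ω
    rw [hx, norm_dtft_flip hhfin]
  · have hh0 : 0 < h 0 := by
      have := hhnat 0
      rw [Nat.cast_zero] at this
      rw [this]
      exact hpos 0 (by omega)
    have hhl : 0 < h (L - 1) := by
      have := hhnat (L - 1)
      rw [Nat.cast_sub (by omega), Nat.cast_one] at this
      rw [this]
      exact hpos _ (by omega)
    have hhL : h L = 0 := by rw [hhnat, hq0 L le_rfl]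
    have hneg1 : h (-1) = 0 := hhneg _ (by norm_num)
    have hne' : h 0 ≠ h (L - 1) := by
      have h1 := hhnat 0
      have h2 := hhnat (L - 1)
      rw [Nat.cast_sub (by omega), Nat.cast_one] at h2
      rw [Nat.cast_zero] at h1
      rwa [h1, h2]
    have hrange : ∀ n, toSignal v n ≠ 0 → 0 ≤ n ∧ n ≤ L := by
      intro n hn
      have := Finset.mem_Icc.1 (hvsupp hn)
      push_cast at this
      omega
    have hx0 : toSignal v 0 = r * h 0 := by
      rw [hx]
      simp [shift, hneg1]
    have hxL : toSignal v L = h (L - 1) := by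
      rw [hx]
      simp [shift, hhL]
    rintro ⟨n₀, heq | heq⟩
    -- Comparing supports forces `n₀ = 0`; then the first entries give `h 0 = r * h 0`, against `r >
    -- 1`.
    · have e0 := congrFun heq 0
      have e1 := congrFun heq n₀
      simp only [shift, zero_sub, sub_self, hneg1, mul_zero, add_zero] at e0 e1
      have b0 := hrange (-n₀) (by rw [← e0]; exact hh0.ne')
      have b1 : 0 ≤ n₀ := by
        by_contra! hlt
        rw [hhneg _ hlt, hhneg _ (by omega), hx0] at e1
        have : 0 < r * h 0 := by positivity
        linarith
      obtain rfl : n₀ = 0 := by omega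
      rw [neg_zero, hx0] at e0
      nlinarith
    -- Here the supports force `n₀ = L`, and the first entry gives `h 0 = h (L - 1)`.
    · have e0 := congrFun heq 0
      have e1 := congrFun heq L
      simp only [shift, reflect, zero_sub, neg_neg, hneg1, hhL, mul_zero, add_zero, zero_add] at e0 e1
      have b0 := hrange n₀ (by rw [← e0]; exact hh0.ne')
      have b1 := hrange (-(L - n₀)) (by rw [← e1]; positivity)
      obtain rfl : n₀ = L := by omega
      rw [hxL] at e0
      exact hne' e0

/-- At the base point the root `-2` is simple, so the remainder changes sign at `r = 2`. The sign
change persists for nearby vectors, and the intermediate value theorem yields a root near `-2`,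
where the quotient is still positive with different ends. -/
theorem exists_ambiguousSignals_mem_nhds {L : ℕ} (hL : 2 ≤ L) :
    ∃ v₀ : Fin (L + 1) → ℝ, ambiguousSignals (L + 1) ∈ 𝓝 v₀ := by
  -- the base point is `(z + 2) h`, where `h` is `(z + 2) e` up to terms of order `L`
  set e : ℕ → ℝ := fun k => if k < L then 1 else -1 / 2 with he
  set h : ℕ → ℝ := fun k => if k = 0 then 2 else if k < L then 3 else 0 with hh
  -- The product `(z + 2)(1 + z + ... + z^(L-1))` is `h + z^L`; the missing `z^L` makes the quotient
  -- coefficient of order `L` equal to `-1/2`. That it is nonzero is the simplicity of the root.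
  have hqe : ∀ k ≤ L, quotCoeff 2 h k = e k := by
    intro k
    induction k with
    | zero =>
      intro _
      simp [quotCoeff, hh, he, show 0 < L by omega]
    | succ k ih =>
      intro hk
      rw [quotCoeff, ih (by omega)]
      simp only [hh, he, Nat.add_eq_zero_iff, one_ne_zero, and_false, if_false,
        if_pos (show k < L by omega)]
      split_ifs <;> norm_num
  set v₀ : Fin (L + 1) → ℝ := fun i => mulCoeff 2 h i with hv₀
  have hv₀s : (fun k : ℕ => toSignal v₀ k) = mulCoeff 2 h := by
    funext k
    rcases Nat.lt_or_ge k (L + 1) with hk | hk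
    · exact toSignal_natCast v₀ ⟨k, hk⟩
    · have : mulCoeff 2 h k = 0 := by
        obtain ⟨j, rfl⟩ : ∃ j, k = j + 1 := ⟨k - 1, by omega⟩
        simp only [mulCoeff, hh]
        rw [if_neg (by omega), if_neg (by omega), if_neg (by omega), if_neg (by omega)]
        norm_num
      rw [this]
      simp only [toSignal]
      rw [dif_neg (by omega)]
  refine ⟨v₀, ?_⟩
  have hcont : ∀ (k : ℕ) (p : (Fin (L + 1) → ℝ) × ℝ), p.2 ≠ 0 →
      ContinuousAt (fun p : (Fin (L + 1) → ℝ) × ℝ => quotCoeff p.2 (fun k => toSignal p.1 k) k) p :=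
    fun k p hp => continuousAt_quotCoeff continuousAt_snd hp
      (fun j => ((toSignal_continuous j).comp continuous_fst).continuousAt) k
  have hbase : ∀ k, quotCoeff 2 (fun k => toSignal v₀ k) k = h k := by
    intro k
    rw [hv₀s, quotCoeff_mulCoeff two_ne_zero]
    ring
  have hgood : ∀ᶠ p : (Fin (L + 1) → ℝ) × ℝ in 𝓝 (v₀, 2),
      (1 < p.2 ∧ ∀ k < L, 0 < quotCoeff p.2 (fun k => toSignal p.1 k) k) ∧
      quotCoeff p.2 (fun k => toSignal p.1 k) 0 <
        quotCoeff p.2 (fun k => toSignal p.1 k) (L - 1) := by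
    refine (Eventually.and ?_ ?_).and ?_
    · exact continuousAt_snd.eventually (lt_mem_nhds (by norm_num))
    · have : ∀ᶠ p : (Fin (L + 1) → ℝ) × ℝ in 𝓝 (v₀, 2), ∀ k ∈ Set.Iio L,
          0 < quotCoeff p.2 (fun k => toSignal p.1 k) k := by
        rw [eventually_all_finite (Set.finite_Iio L)]
        intro k hk
        refine (hcont k (v₀, 2) two_ne_zero).eventually (lt_mem_nhds ?_)
        simp only [hbase, hh]
        split_ifs with h1 h2
        exacts [by norm_num, by norm_num, absurd hk h2]
      exact this
    · refine (hcont 0 (v₀, 2) two_ne_zero).eventually_lt (hcont (L - 1) (v₀, 2) two_ne_zero) ?_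
      simp only [hbase]
      simp only [hh]
      rw [if_pos trivial, if_neg (by omega), if_pos (by omega)]
      norm_num
  -- Separating the conditions on `v` and `r` lets the interval for `r` be fixed before `v` is
  -- restricted.
  rw [nhds_prod_eq] at hgood
  obtain ⟨pv, hpv, pr, hpr, hgood⟩ := eventually_prod_iff.1 hgood
  have hE : ∀ᶠ r : ℝ in 𝓝 2, quotCoeff r h L < 0 := by
    refine (continuousAt_quotCoeff_left two_ne_zero h L).eventually (gt_mem_nhds ?_)
    simp only [hqe L le_rfl, he, lt_irrefl, if_false]
    norm_num
  obtain ⟨ε, hε, hball⟩ := Metric.eventually_nhds_iff_ball.1 ((hpr.and hE).and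
    (lt_mem_nhds (show (0 : ℝ) < 2 by norm_num)))
  have hmem : ∀ r ∈ Set.Icc (2 - ε / 2) (2 + ε / 2), r ∈ Metric.ball (2 : ℝ) ε := by
    intro r hr
    rw [Metric.mem_ball, Real.dist_eq, abs_lt]
    constructor <;> linarith [hr.1, hr.2]
  have h1 := hball _ (hmem (2 - ε / 2) ⟨le_rfl, by linarith⟩)
  have h2 := hball _ (hmem (2 + ε / 2) ⟨by linarith, le_rfl⟩)
  have hhL : h L = 0 := by
    simp only [hh]
    rw [if_neg (by omega), if_neg (lt_irrefl L)]
  -- The second factor is negative for `r` near 2, so the sign is that of `r - 2`.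
  have hval : ∀ r : ℝ, r ≠ 0 → quotCoeff r (fun k => toSignal v₀ k) L =
      (2 - r) * quotCoeff r h L := fun r hr => by
    rw [hv₀s, quotCoeff_mulCoeff hr, hhL, zero_add]
  have hslice : ∀ r : ℝ, r ≠ 0 → ContinuousAt
      (fun v : Fin (L + 1) → ℝ => quotCoeff r (fun k => toSignal v k) L) v₀ := fun r hr =>
    continuousAt_quotCoeff continuousAt_const hr (fun j => (toSignal_continuous j).continuousAt) L
  have hlow : ∀ᶠ v in 𝓝 v₀, quotCoeff (2 - ε / 2) (fun k => toSignal v k) L < 0 := by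
    refine (hslice _ h1.2.ne').eventually (gt_mem_nhds ?_)
    simp only [hval _ h1.2.ne']
    nlinarith [h1.1.2]
  have hhigh : ∀ᶠ v in 𝓝 v₀, 0 < quotCoeff (2 + ε / 2) (fun k => toSignal v k) L := by
    refine (hslice _ h2.2.ne').eventually (lt_mem_nhds ?_)
    simp only [hval _ h2.2.ne']
    nlinarith [h2.1.2]
  filter_upwards [hpv, hlow, hhigh] with v hv hv1 hv2
  have hIVT := intermediate_value_Icc (show 2 - ε / 2 ≤ 2 + ε / 2 by linarith)
    (f := fun r => quotCoeff r (fun k => toSignal v k) L) (fun r hr =>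
      (continuousAt_quotCoeff_left (hball r (hmem r hr)).2.ne' _ L).continuousWithinAt)
  obtain ⟨r, hr, hroot⟩ := hIVT ⟨hv1.le, hv2.le⟩
  obtain ⟨⟨hr1, hrpos⟩, hrlt⟩ := hgood hv (hball r (hmem r hr)).1.1
  exact mem_ambiguousSignals_of_quotCoeff hL hr1 hroot hrpos hrlt.ne

end PhaseRetrieval

theorem mainTheorem1 (N : ℕ) (hN : 0 < N) :
    (¬ Bornology.IsBounded (PhaseRetrieval.uniqueSignals N) ∧
      PhaseRetrieval.ContainsInfiniteCone (PhaseRetrieval.uniqueSignals N)) ∧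
    (3 ≤ N →
      ¬ Bornology.IsBounded (PhaseRetrieval.ambiguousSignals N) ∧
        PhaseRetrieval.ContainsInfiniteCone (PhaseRetrieval.ambiguousSignals N)) := by
  constructor
  · obtain ⟨v₀, hv₀⟩ := PhaseRetrieval.exists_uniqueSignals_mem_nhds hN
    have hcone := PhaseRetrieval.containsInfiniteCone_of_mem_nhds hN
      (fun c hc v hv => PhaseRetrieval.smul_mem_uniqueSignals hc hv) hv₀
    exact ⟨hcone.not_isBounded, hcone⟩
  · intro hN3
    obtain ⟨L, rfl⟩ : ∃ L, N = L + 1 := ⟨N - 1, by omega⟩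
    obtain ⟨v₀, hv₀⟩ := PhaseRetrieval.exists_ambiguousSignals_mem_nhds (L := L) (by omega)
    have hcone := PhaseRetrieval.containsInfiniteCone_of_mem_nhds hN
      (fun c hc v hv => PhaseRetrieval.smul_mem_ambiguousSignals hc hv) hv₀
    exact ⟨hcone.not_isBounded, hcone⟩
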